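/- Consider a two-period overlapping generations economy, $t=0,1,2,\dots$, with a perishable consumption good, housing service, and one unit of housing stock, which yields one unit of housing service per period and is initially owned by the old. The endowments of the consumption good are $e_t^y>0$ for the young and $e_t^o>0$ for the old. The generation born at $t$ maximizes $U(c_t^y,c_{t+1}^o,h_t)$ subject to $c_t^y+P_tx_t+r_th_t\le e_t^y$ and $c_{t+1}^o\le e_{t+1}^o+(P_{t+1}+r_{t+1})x_t$, where $h_t$ is the housing service it rents, $x_t$ its demand for the housing stock, $P_t\ge 0$ the housing price and $r_t\ge 0$ the rent; the initial old care only about $c_0^o$. An equilibrium consists of sequences of prices and allocations such that every generation optimizes and, for all $t$, $c_t^y+c_t^o=e_t^y+e_t^o$, $h_t=1$ and $x_t=1$. An equilibrium is efficient if no feasible allocation ($c_t^y,c_t^o>0$, $c_t^y+c_t^o=e_t^y+e_t^o$, $0<h_t\le 1$) makes nobody worse off and somebody (a generation or the initial old) better off; otherwise it is inefficient. Assume the following. (a) There are $G>1$, $e_1,e_2>0$ and $T>0$ such that $(e_t^y,e_t^o)=(e_1G^t,e_2G^t)$ for $t\ge T$; let $w=e_2/e_1$. (b) $U(y,z,h)=u(c(y,z))+v(h)$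 with $u(x)=\frac{x^{1-\gamma}}{1-\gamma}$, $0<\gamma<1$, and $v$ continuously differentiable on $(0,\infty)$ with $v'>0$; let $m=v'(1)$. (c) $c:(0,\infty)^2\to(0,\infty)$ is homogeneous of degree 1, quasi-concave and twice continuously differentiable, with $c_y>0$, $c_z>0$, $c_{yy}<0$, $c_{zz}<0$, $\lim_{y\downarrow 0}c_y(y,z)=\infty$ for all $z>0$ and $\lim_{z\downarrow 0}c_z(y,z)=\infty$ for all $y>0$. Let $S_t=P_t+r_t$, $R_t=S_{t+1}/P_t$ and $q_t=1/\prod_{s=0}^{t-1}R_s$. An equilibrium has no housing bubble if $P_t=\frac{1}{q_t}\sum_{s=t+1}^\infty q_sr_s$ for all $t$. Let $\xi_t=(\xi_{1t},\xi_{2t})=\bigl(S_t/(e_1G^t),\,e_1^{\gamma-1}G^{(\gamma-1)t}\bigr)$. The equilibrium dynamics are eventually $\Phi(\xi_t,\xi_{t+1})=0$ with $$\Phi(\xi,\eta)=\bigl(G\eta_1c_z-\xi_1c_y+mc^\gamma\xi_2,\ \eta_2-G^{\gamma-1}\xi_2\bigr),$$ where $c,c_y,c_z$ are evaluated at $(1-\xi_1,G(w+\eta_1))$.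 A steady state is a $\xi$ with $0\le\xi_1<1$ and $\Phi(\xi,\xi)=0$; $(0,0)$ is the fundamental steady state, and a steady state with $\xi_1>0$ is called bubbly. An equilibrium is a long run equilibrium if $\xi_t$ converges. A bubbly long run equilibrium is one in which $\xi_t$ converges to a bubbly steady state. A fundamental long run equilibrium is a long run equilibrium which has no housing bubble or in which $\xi_t$ converges to the fundamental steady state. Then there is a unique $w_b^*>0$ with $\frac{c_y}{c_z}(1,Gw_b^*)=G$, and the following hold. (i) If $w\ge w_b^*$, every equilibrium is efficient. (ii) If $w<w_b^*$, every bubbly long run equilibrium is efficient. (iii) If $w<w_b^*$, every fundamental long run equilibrium is inefficient. -/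

import Mathlib

open Filter Topology Set

noncomputable section

namespace HousingOLG

/-! ## The economy: endowments, allocations, equilibrium -/

/-- Endowments of the consumption good of the young (`ey`) and of the old (`eo`) at each date,
and the utility `U y z h` of every generation (consumption when young, consumption when old,
housing service). Only the values of `U` at positive arguments are ever used. The initial old
care only about their consumption. The housing stock is one and yields one unit of housing
service per period. -/
structure Economy where
  ey : ℕ → ℝ
  eo : ℕ → ℝ
  U : ℝ → ℝ → ℝ → ℝ
  ey_pos : ∀ t, 0 < ey t
  eo_pos : ∀ t, 0 < eo t

/-- Consumption of the young and of the old, and housing service of the young, at each date. -/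
structure Allocation where
  cy : ℕ → ℝ
  co : ℕ → ℝ
  h : ℕ → ℝ

/-- Housing prices `P` (excluding current rent), rents `r`, an allocation, and demands `x` for the
housing stock. -/
structure MarketPath extends Allocation where
  P : ℕ → ℝ
  r : ℕ → ℝ
  x : ℕ → ℝ

/-- The consumption plan `(y, z, k)` together with the housing stock demand `a` satisfies the two
budget constraints of the generation born at `t`. -/
def InBudget (E : Economy) (p : MarketPath) (t : ℕ) (y z k a : ℝ) : Prop :=
  0 < y ∧ 0 < z ∧ 0 < k ∧
    y + p.P t * a + p.r t * k ≤ E.ey t ∧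
    z ≤ E.eo (t + 1) + (p.P (t + 1) + p.r (t + 1)) * a

/-- Rational expectations equilibrium. -/
structure IsEquilibrium (E : Economy) (p : MarketPath) : Prop where
  price_nonneg : ∀ t, 0 ≤ p.P t
  rent_nonneg : ∀ t, 0 ≤ p.r t
  affordable : ∀ t, InBudget E p t (p.cy t) (p.co (t + 1)) (p.h t) (p.x t)
  optimal : ∀ t y z k a, InBudget E p t y z k a →
    E.U y z k ≤ E.U (p.cy t) (p.co (t + 1)) (p.h t)
  commodity_clears : ∀ t, p.cy t + p.co t = E.ey t + E.eo t
  rental_clears : ∀ t, p.h t = 1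
  housing_clears : ∀ t, p.x t = 1

/-! ## Pareto efficiency -/

/-- Feasible allocations. The part `1 - h t` of the housing service that the young do not use goes
to the old, who do not value it. -/
def Feasible (E : Economy) (a : Allocation) : Prop :=
  ∀ t, 0 < a.cy t ∧ 0 < a.co t ∧ 0 < a.h t ∧ a.h t ≤ 1 ∧ a.cy t + a.co t = E.ey t + E.eo t

/-- Utility of the generation born at `t`. -/
def genUtility (E : Economy) (a : Allocation) (t : ℕ) : ℝ :=
  E.U (a.cy t) (a.co (t + 1)) (a.h t)

/-- `b` Pareto dominates `a`: nobody (the initial old and all generations) is worse off and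
somebody is better off. -/
def Dominates (E : Economy) (b a : Allocation) : Prop :=
  a.co 0 ≤ b.co 0 ∧ (∀ t, genUtility E a t ≤ genUtility E b t) ∧
    (a.co 0 < b.co 0 ∨ ∃ t, genUtility E a t < genUtility E b t)

/-- Pareto efficiency (of a feasible allocation). -/
def ParetoEfficient (E : Economy) (a : Allocation) : Prop :=
  ¬ ∃ b : Allocation, Feasible E b ∧ Dominates E b a

/-! ## Assumptions on endowments and preferences -/

/-- Endowments are eventually `(e₁ G ^ t, e₂ G ^ t)`. -/
structure EndowmentAssumption (E : Economy) (G e₁ e₂ : ℝ) : Prop where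
  one_lt : 1 < G
  young_pos : 0 < e₁
  old_pos : 0 < e₂
  eventually_eq : ∃ T : ℕ, 0 < T ∧ ∀ t, T ≤ t → E.ey t = e₁ * G ^ t ∧ E.eo t = e₂ * G ^ t

/-- Partial derivative with respect to the first argument. -/
def dy (f : ℝ → ℝ → ℝ) (y z : ℝ) : ℝ := deriv (fun y' => f y' z) y

/-- Partial derivative with respect to the second argument. -/
def dz (f : ℝ → ℝ → ℝ) (y z : ℝ) : ℝ := deriv (fun z' => f y z') z

/-- Composite consumption `c`, a function on the open positive quadrant. -/
structure CompositeAssumption (c : ℝ → ℝ → ℝ) : Prop where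
  pos : ∀ y z, 0 < y → 0 < z → 0 < c y z
  homogeneous : ∀ l y z, 0 < l → 0 < y → 0 < z → c (l * y) (l * z) = l * c y z
  quasiconcave : QuasiconcaveOn ℝ (Ioi (0 : ℝ) ×ˢ Ioi (0 : ℝ)) (fun p : ℝ × ℝ => c p.1 p.2)
  contDiff : ContDiffOn ℝ 2 (fun p : ℝ × ℝ => c p.1 p.2) (Ioi (0 : ℝ) ×ˢ Ioi (0 : ℝ))
  dy_pos : ∀ y z, 0 < y → 0 < z → 0 < dy c y z
  dz_pos : ∀ y z, 0 < y → 0 < z → 0 < dz c y z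
  dyy_neg : ∀ y z, 0 < y → 0 < z → dy (dy c) y z < 0
  dzz_neg : ∀ y z, 0 < y → 0 < z → dz (dz c) y z < 0
  dy_inada : ∀ z, 0 < z → Tendsto (fun y => dy c y z) (𝓝[>] 0) atTop
  dz_inada : ∀ y, 0 < y → Tendsto (fun z => dz c y z) (𝓝[>] 0) atTop

/-- Utility of composite consumption, with constant elasticity. -/
def crra (γ x : ℝ) : ℝ := if γ = 1 then Real.log x else x ^ (1 - γ) / (1 - γ)

/-- `U (y, z, h) = u (c (y, z)) + v h`, with `u` of constant elasticity `γ > 0` and `v` continuously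
differentiable with `v' > 0`. -/
structure UtilityAssumption (E : Economy) (c : ℝ → ℝ → ℝ) (γ : ℝ) (v : ℝ → ℝ) : Prop where
  gamma_pos : 0 < γ
  separable : ∀ y z k, 0 < y → 0 < z → 0 < k → E.U y z k = crra γ (c y z) + v k
  v_contDiff : ContDiffOn ℝ 1 v (Ioi 0)
  v_deriv_pos : ∀ k, 0 < k → 0 < deriv v k

/-! ## Interest rate, fundamental value, bubbles -/

/-- Housing expenditure. -/
def MarketPath.S (p : MarketPath) (t : ℕ) : ℝ := p.P t + p.r t

/-- Gross risk-free rate between `t` and `t + 1`. -/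
def MarketPath.R (p : MarketPath) (t : ℕ) : ℝ := (p.P (t + 1) + p.r (t + 1)) / p.P t

/-- Arrow-Debreu price of date-`t` consumption. -/
def MarketPath.q (p : MarketPath) (t : ℕ) : ℝ := 1 / ∏ s ∈ Finset.range t, p.R s

/-- Fundamental value of housing: the present value of future rents. -/
def MarketPath.V (p : MarketPath) (t : ℕ) : ℝ :=
  (1 / p.q t) * ∑' n : ℕ, p.q (t + 1 + n) * p.r (t + 1 + n)

/-- There is no housing bubble: at every date the present value of rents is finite and equals the
housing price. -/
def MarketPath.NoBubble (p : MarketPath) : Prop :=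
  ∀ t, Summable (fun n : ℕ => p.q (t + 1 + n) * p.r (t + 1 + n)) ∧ p.P t = p.V t

/-! ## Steady states and long run equilibria -/

/-- The map of the autonomous system `Φ (ξ_t, ξ_{t+1}) = 0` of the detrended economy, where `w` is
the ratio of old to young income and `m` the marginal utility of housing service at one. -/
def Phi (c : ℝ → ℝ → ℝ) (γ G w m : ℝ) (ξ η : ℝ × ℝ) : ℝ × ℝ :=
  (G * η.1 * dz c (1 - ξ.1) (G * (w + η.1)) - ξ.1 * dy c (1 - ξ.1) (G * (w + η.1))
      + m * c (1 - ξ.1) (G * (w + η.1)) ^ γ * ξ.2,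
    η.2 - G ^ (γ - 1) * ξ.2)

/-- Steady states of `Φ` (with a housing expenditure share in `[0, 1)`, where `Φ` makes sense). -/
def IsSteadyState (c : ℝ → ℝ → ℝ) (γ G w m : ℝ) (ξ : ℝ × ℝ) : Prop :=
  0 ≤ ξ.1 ∧ ξ.1 < 1 ∧ Phi c γ G w m ξ ξ = 0

/-- Bubbly steady states: the nontrivial ones. The fundamental steady state is `(0, 0)`. -/
def IsBubblySteadyState (c : ℝ → ℝ → ℝ) (γ G w m : ℝ) (ξ : ℝ × ℝ) : Prop :=
  IsSteadyState c γ G w m ξ ∧ 0 < ξ.1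

/-- The auxiliary variables `ξ_t = (S_t / (e₁ G ^ t), e₁ ^ (γ - 1) G ^ ((γ - 1) t))`. -/
def auxVar (γ G e₁ : ℝ) (p : MarketPath) (t : ℕ) : ℝ × ℝ :=
  (p.S t / (e₁ * G ^ t), e₁ ^ (γ - 1) * G ^ ((γ - 1) * (t : ℝ)))

/-- Long run equilibrium: the auxiliary variables converge. -/
def IsLongRunEquilibrium (E : Economy) (γ G e₁ : ℝ) (p : MarketPath) : Prop :=
  IsEquilibrium E p ∧ ∃ ξ : ℝ × ℝ, Tendsto (auxVar γ G e₁ p) atTop (𝓝 ξ)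

/-- `wb` is the income ratio threshold: `(c_y / c_z) (1, G wb) = G`. -/
def IsBubbleThreshold (c : ℝ → ℝ → ℝ) (G wb : ℝ) : Prop :=
  0 < wb ∧ dy c 1 (G * wb) / dz c 1 (G * wb) = G

end HousingOLG

end

open HousingOLG

/-!
Composite consumption is homogeneous of degree one with strictly concave sections, so it is concave,
strictly so off rays, and `c_y / c_z` depends on `z / y` only, through the strictly increasing
function `mrs c`. The Inada conditions and the intermediate value theorem give the threshold. In
equilibrium the first-order condition for the housing stock says that the interest rate `p.R t` is
the marginal rate of substitution of the generation born at `t`.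

*Efficiency.* If an allocation dominates the equilibrium, the present value of the gain of the old
is nondecreasing and eventually positive (`gain_monotone`). The gain is at most the income of the
young, so if the present value of trend income `p.q t * G ^ t` tends to zero there is no such
allocation. If it converges to a positive number and the equilibrium converges to a stationary
allocation with interest rate `G`, the gain per unit of trend income converges to a positive number,
so in the limit a stationary transfer from young to old does no harm. Strict concavity excludes
this, as `G` is exactly the rate at which such a transfer is repaid (`paretoEfficient_of_tendsto`).
No bound on the curvature of preferences is needed.

Above the threshold, interest rates exceed `G` eventually, so the present value of trend income is
eventually decreasing, and it stays away from zero only if housing expenditure vanishes in the limit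
and interest rates tend to `G`. In a bubbly steady state the interest rate is `G`, and the present
value of housing expenditure, which converges, is proportional to that of trend income.

*Inefficiency.* If housing expenditure vanishes relative to trend income and the economy is below
the threshold, a transfer that is a fixed share of trend income, started late enough, benefits
everyone concerned (`not_paretoEfficient_of_tendsto_zero`). An equilibrium without bubble is of this
kind: since `γ < 1`, rents grow more slowly than income (`exists_rent_le`), so if housing expenditure
were a positive share of income in the limit, the present value of rents would fall short of the
price (`tendsto_zero_of_noBubble`).
-/

namespace HousingOLG

variable {c : ℝ → ℝ → ℝ}

/-! ### Homogeneity and concavity of composite consumption -/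

namespace CompositeAssumption

lemma eq_mul_ratio (hc : CompositeAssumption c) {y z : ℝ} (hy : 0 < y) (hz : 0 < z) :
    c y z = z * c (y / z) 1 := by
  rw [← hc.homogeneous z (y / z) 1 hz (div_pos hy hz) one_pos, mul_div_cancel₀ _ hz.ne', mul_one]

lemma contDiffOn_section (hc : CompositeAssumption c) :
    ContDiffOn ℝ 2 (fun x => c x 1) (Ioi 0) :=
  hc.contDiff.comp (f := fun x : ℝ => (x, (1 : ℝ))) (by fun_prop)
    (fun _ hx => ⟨hx, mem_Ioi.2 one_pos⟩)

lemma hasDerivAt_section (hc : CompositeAssumption c) {x : ℝ} (hx : 0 < x) :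
    HasDerivAt (fun x => c x 1) (dy c x 1) x :=
  ((hc.contDiffOn_section.differentiableOn (by norm_num)).differentiableAt
    (Ioi_mem_nhds hx)).hasDerivAt

/-- Chain rule for `c (y, z) = z * c (y / z, 1)`, in terms of the section `c (·, 1)` only. -/
lemma hasDerivAt_comp_section (hc : CompositeAssumption c) {a b : ℝ → ℝ} {a' b' t : ℝ}
    (ha : HasDerivAt a a' t) (hb : HasDerivAt b b' t) (hat : 0 < a t) (hbt : 0 < b t) :
    HasDerivAt (fun s => c (a s) (b s))
      (a' * dy c (a t / b t) 1 + b' * (c (a t / b t) 1 - a t / b t * dy c (a t / b t) 1)) t := by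
  have h := hb.mul ((hc.hasDerivAt_section (div_pos hat hbt)).comp t (ha.div hb hbt.ne'))
  have hev : (fun s => c (a s) (b s)) =ᶠ[𝓝 t] b * ((fun x => c x 1) ∘ (a / b)) := by
    filter_upwards [ha.continuousAt.eventually (lt_mem_nhds hat),
      hb.continuousAt.eventually (lt_mem_nhds hbt)] with s h1 h2
    exact hc.eq_mul_ratio h1 h2
  refine (h.congr_of_eventuallyEq hev).congr_deriv ?_
  simp only [Function.comp_apply, Pi.div_apply]
  field_simp
  ring

lemma dy_eq_section (hc : CompositeAssumption c) {y z : ℝ} (hy : 0 < y) (hz : 0 < z) :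
    dy c y z = dy c (y / z) 1 := by
  have h := hc.hasDerivAt_comp_section (hasDerivAt_id y) (hasDerivAt_const y z) hy hz
  exact h.deriv.trans (by simp)

lemma dz_eq_section (hc : CompositeAssumption c) {y z : ℝ} (hy : 0 < y) (hz : 0 < z) :
    dz c y z = c (y / z) 1 - y / z * dy c (y / z) 1 := by
  have h := hc.hasDerivAt_comp_section (hasDerivAt_const z y) (hasDerivAt_id z) hy hz
  exact h.deriv.trans (by simp)

lemma hasDerivAt_comp (hc : CompositeAssumption c) {a b : ℝ → ℝ} {a' b' t : ℝ}
    (ha : HasDerivAt a a' t) (hb : HasDerivAt b b' t) (hat : 0 < a t) (hbt : 0 < b t) :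
    HasDerivAt (fun s => c (a s) (b s)) (a' * dy c (a t) (b t) + b' * dz c (a t) (b t)) t := by
  rw [hc.dy_eq_section hat hbt, hc.dz_eq_section hat hbt]
  exact hc.hasDerivAt_comp_section ha hb hat hbt

/-- Euler's identity. -/
lemma euler (hc : CompositeAssumption c) {y z : ℝ} (hy : 0 < y) (hz : 0 < z) :
    dy c y z * y + dz c y z * z = c y z := by
  rw [hc.dy_eq_section hy hz, hc.dz_eq_section hy hz, hc.eq_mul_ratio hy hz]
  field_simp
  ring

lemma dy_scale (hc : CompositeAssumption c) {l y z : ℝ} (hl : 0 < l) (hy : 0 < y) (hz : 0 < z) :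
    dy c (l * y) (l * z) = dy c y z := by
  rw [hc.dy_eq_section (mul_pos hl hy) (mul_pos hl hz), hc.dy_eq_section hy hz,
    mul_div_mul_left _ _ hl.ne']

lemma dz_scale (hc : CompositeAssumption c) {l y z : ℝ} (hl : 0 < l) (hy : 0 < y) (hz : 0 < z) :
    dz c (l * y) (l * z) = dz c y z := by
  rw [hc.dz_eq_section (mul_pos hl hy) (mul_pos hl hz), hc.dz_eq_section hy hz,
    mul_div_mul_left _ _ hl.ne']

lemma strictAntiOn_dy_section (hc : CompositeAssumption c) :
    StrictAntiOn (fun x => dy c x 1) (Ioi 0) := by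
  refine strictAntiOn_of_deriv_neg (convex_Ioi 0)
    (hc.contDiffOn_section.continuousOn_deriv_of_isOpen isOpen_Ioi (by norm_num)) ?_
  intro x hx
  rw [interior_Ioi] at hx
  exact hc.dyy_neg x 1 hx one_pos

lemma continuousAt_dy_section (hc : CompositeAssumption c) {x : ℝ} (hx : 0 < x) :
    ContinuousAt (fun x => dy c x 1) x :=
  (hc.contDiffOn_section.continuousOn_deriv_of_isOpen isOpen_Ioi (by norm_num)).continuousAt
    (Ioi_mem_nhds hx)

lemma section_lt_tangent (hc : CompositeAssumption c) {x x' : ℝ} (hx : 0 < x) (hx' : 0 < x')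
    (hne : x' ≠ x) : c x' 1 < c x 1 + dy c x 1 * (x' - x) := by
  have hcont : ContinuousOn (fun x => c x 1) (Ioi 0) := hc.contDiffOn_section.continuousOn
  rcases lt_or_gt_of_ne hne with h | h
  · obtain ⟨k, hk, hk'⟩ := exists_hasDerivAt_eq_slope (fun x => c x 1) (fun x => dy c x 1) h
      (hcont.mono fun u hu => hx'.trans_le hu.1)
      (fun u hu => hc.hasDerivAt_section (hx'.trans hu.1))
    have := hc.strictAntiOn_dy_section (hx'.trans hk.1) hx hk.2
    simp only at this
    rw [hk', lt_div_iff₀ (by linarith)] at this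
    linarith
  · obtain ⟨k, hk, hk'⟩ := exists_hasDerivAt_eq_slope (fun x => c x 1) (fun x => dy c x 1) h
      (hcont.mono fun u hu => hx.trans_le hu.1)
      (fun u hu => hc.hasDerivAt_section (hx.trans hu.1))
    have := hc.strictAntiOn_dy_section hx (hx.trans hk.1) hk.1
    simp only at this
    rw [hk', div_lt_iff₀ (by linarith)] at this
    linarith

/-- Composite consumption lies below its tangent planes, which pass through the origin by Euler's
identity, strictly so off the ray of the point of tangency. -/
lemma lt_tangent (hc : CompositeAssumption c) {y z y' z' : ℝ} (hy : 0 < y) (hz : 0 < z)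
    (hy' : 0 < y') (hz' : 0 < z') (hne : y' * z ≠ y * z') :
    c y' z' < dy c y z * y' + dz c y z * z' := by
  rw [hc.dy_eq_section hy hz, hc.dz_eq_section hy hz, hc.eq_mul_ratio hy' hz']
  have hne' : y' / z' ≠ y / z := fun h => hne ((div_eq_div_iff hz'.ne' hz.ne').1 h)
  have h := mul_lt_mul_of_pos_left
    (hc.section_lt_tangent (div_pos hy hz) (div_pos hy' hz') hne') hz'
  refine h.trans_eq ?_
  have h1 : z' * (y' / z') = y' := mul_div_cancel₀ _ hz'.ne'
  linear_combination dy c (y / z) 1 * h1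

lemma le_tangent (hc : CompositeAssumption c) {y z y' z' : ℝ} (hy : 0 < y) (hz : 0 < z)
    (hy' : 0 < y') (hz' : 0 < z') :
    c y' z' ≤ dy c y z * y' + dz c y z * z' := by
  by_cases hne : y' * z = y * z'
  · have h1 : y' = z' / z * y := by field_simp; linarith
    have h2 : z' = z' / z * z := by field_simp
    have h3 := hc.homogeneous (z' / z) y z (div_pos hz' hz) hy hz
    rw [← h1, ← h2, ← hc.euler hy hz] at h3
    rw [h3]
    refine le_of_eq ?_
    linear_combination -dy c y z * h1 - dz c y z * h2
  · exact (hc.lt_tangent hy hz hy' hz' hne).le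

lemma strictMonoOn_fst (hc : CompositeAssumption c) {z : ℝ} (hz : 0 < z) :
    StrictMonoOn (fun y => c y z) (Ioi 0) := by
  have hd : ∀ y, 0 < y → HasDerivAt (fun y => c y z) (dy c y z) y := fun y hy => by
    simpa using hc.hasDerivAt_comp (hasDerivAt_id y) (hasDerivAt_const y z) hy hz
  refine strictMonoOn_of_deriv_pos (convex_Ioi 0)
    (fun y hy => (hd y hy).continuousAt.continuousWithinAt) fun y hy => ?_
  rw [interior_Ioi] at hy
  exact hc.dy_pos y z hy hz

lemma strictMonoOn_snd (hc : CompositeAssumption c) {y : ℝ} (hy : 0 < y) :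
    StrictMonoOn (fun z => c y z) (Ioi 0) := by
  have hd : ∀ z, 0 < z → HasDerivAt (fun z => c y z) (dz c y z) z := fun z hz => by
    simpa using hc.hasDerivAt_comp (hasDerivAt_const z y) (hasDerivAt_id z) hy hz
  refine strictMonoOn_of_deriv_pos (convex_Ioi 0)
    (fun z hz => (hd z hz).continuousAt.continuousWithinAt) fun z hz => ?_
  rw [interior_Ioi] at hz
  exact hc.dz_pos y z hy hz

variable {α : Type*} {l : Filter α} {a b : α → ℝ} {y z : ℝ}

lemma tendsto_comp (hc : CompositeAssumption c) (ha : Tendsto a l (𝓝 y)) (hb : Tendsto b l (𝓝 z))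
    (hy : 0 < y) (hz : 0 < z) : Tendsto (fun i => c (a i) (b i)) l (𝓝 (c y z)) :=
  ((hc.contDiff.continuousOn.continuousAt
    (prod_mem_nhds (Ioi_mem_nhds hy) (Ioi_mem_nhds hz))).tendsto).comp (ha.prodMk_nhds hb)

lemma tendsto_dy (hc : CompositeAssumption c) (ha : Tendsto a l (𝓝 y)) (hb : Tendsto b l (𝓝 z))
    (hy : 0 < y) (hz : 0 < z) : Tendsto (fun i => dy c (a i) (b i)) l (𝓝 (dy c y z)) := by
  rw [hc.dy_eq_section hy hz]
  refine (((hc.continuousAt_dy_section (div_pos hy hz)).tendsto).comp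
    (ha.div hb hz.ne')).congr' ?_
  filter_upwards [ha.eventually (lt_mem_nhds hy), hb.eventually (lt_mem_nhds hz)] with i h1 h2
  exact (hc.dy_eq_section h1 h2).symm

lemma tendsto_dz (hc : CompositeAssumption c) (ha : Tendsto a l (𝓝 y)) (hb : Tendsto b l (𝓝 z))
    (hy : 0 < y) (hz : 0 < z) : Tendsto (fun i => dz c (a i) (b i)) l (𝓝 (dz c y z)) := by
  have h : Tendsto (fun i => (c (a i) (b i) - dy c (a i) (b i) * a i) / b i) l
      (𝓝 ((c y z - dy c y z * y) / z)) :=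
    ((hc.tendsto_comp ha hb hy hz).sub ((hc.tendsto_dy ha hb hy hz).mul ha)).div hb hz.ne'
  have e : ∀ {y z : ℝ}, 0 < y → 0 < z → (c y z - dy c y z * y) / z = dz c y z := by
    intro y z hy hz
    rw [← hc.euler hy hz]
    field_simp
    ring
  rw [e hy hz] at h
  refine h.congr' ?_
  filter_upwards [ha.eventually (lt_mem_nhds hy), hb.eventually (lt_mem_nhds hz)] with i h1 h2
  exact e h1 h2

end CompositeAssumption

/-! ### The marginal rate of substitution and the threshold -/

/-- The marginal rate of substitution `c_y / c_z` as a function of the ratio `k = z / y`, on which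
alone it depends because `c` is homogeneous. -/
noncomputable def mrs (c : ℝ → ℝ → ℝ) (k : ℝ) : ℝ := dy c 1 k / dz c 1 k

namespace CompositeAssumption

lemma mrs_ratio (hc : CompositeAssumption c) {y z : ℝ} (hy : 0 < y) (hz : 0 < z) :
    mrs c (z / y) = dy c y z / dz c y z := by
  have h1 := hc.dy_scale hy one_pos (div_pos hz hy)
  have h2 := hc.dz_scale hy one_pos (div_pos hz hy)
  rw [mul_one, mul_div_cancel₀ _ hy.ne'] at h1 h2
  rw [mrs, h1, h2]

lemma strictMonoOn_dy_one (hc : CompositeAssumption c) :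
    StrictMonoOn (fun k => dy c 1 k) (Ioi 0) := by
  intro k hk k' hk' h
  simp only [mem_Ioi] at hk hk'
  simp only
  rw [hc.dy_eq_section one_pos hk, hc.dy_eq_section one_pos hk']
  exact hc.strictAntiOn_dy_section (mem_Ioi.2 (by positivity)) (mem_Ioi.2 (by positivity))
    (one_div_lt_one_div_of_lt hk h)

lemma strictAntiOn_dz_one (hc : CompositeAssumption c) :
    StrictAntiOn (fun k => dz c 1 k) (Ioi 0) := by
  refine strictAntiOn_of_deriv_neg (convex_Ioi 0) (fun k hk => ?_) fun k hk => ?_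
  · exact ContinuousAt.continuousWithinAt
      (hc.tendsto_dz tendsto_const_nhds tendsto_id one_pos hk)
  · rw [interior_Ioi] at hk
    exact hc.dzz_neg 1 k one_pos hk

lemma strictMonoOn_mrs (hc : CompositeAssumption c) : StrictMonoOn (mrs c) (Ioi 0) := by
  intro k hk k' hk' h
  exact div_lt_div₀ (hc.strictMonoOn_dy_one hk hk' h) (hc.strictAntiOn_dz_one hk hk' h).le
    (hc.dy_pos 1 k' one_pos hk').le (hc.dz_pos 1 k' one_pos hk')

lemma tendsto_mrs (hc : CompositeAssumption c) {α : Type*} {l : Filter α} {a : α → ℝ} {k : ℝ}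
    (ha : Tendsto a l (𝓝 k)) (hk : 0 < k) : Tendsto (fun i => mrs c (a i)) l (𝓝 (mrs c k)) :=
  (hc.tendsto_dy tendsto_const_nhds ha one_pos hk).div
    (hc.tendsto_dz tendsto_const_nhds ha one_pos hk) (hc.dz_pos 1 k one_pos hk).ne'

lemma tendsto_mrs_atTop (hc : CompositeAssumption c) : Tendsto (mrs c) atTop atTop := by
  have h1 : Tendsto (fun k : ℝ => dy c 1 k) atTop atTop := by
    refine ((hc.dy_inada 1 one_pos).comp tendsto_inv_atTop_nhdsGT_zero).congr' ?_
    filter_upwards [eventually_gt_atTop 0] with k hk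
    rw [Function.comp_apply, hc.dy_eq_section one_pos hk, one_div]
  refine tendsto_atTop_mono' atTop ?_ (h1.atTop_div_const (hc.dz_pos 1 1 one_pos one_pos))
  filter_upwards [eventually_ge_atTop 1] with k hk
  have hk0 : 0 < k := by linarith
  exact div_le_div_of_nonneg_left (hc.dy_pos 1 k one_pos hk0).le (hc.dz_pos 1 k one_pos hk0)
    (hc.strictAntiOn_dz_one.antitoneOn (mem_Ioi.2 one_pos) hk0 hk)

lemma exists_mrs_lt (hc : CompositeAssumption c) {G : ℝ} (hG : 0 < G) :
    ∃ k, 0 < k ∧ mrs c k < G := by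
  have h := (hc.dz_inada 1 one_pos).eventually (eventually_gt_atTop (dy c 1 1 / G))
  obtain ⟨k, h1, h2⟩ := (h.and (Ioo_mem_nhdsGT one_pos)).exists
  refine ⟨k, h2.1, ?_⟩
  rw [mrs, div_lt_iff₀ (hc.dz_pos 1 k one_pos h2.1)]
  rw [div_lt_iff₀ hG] at h1
  have := hc.strictMonoOn_dy_one h2.1 (mem_Ioi.2 one_pos) h2.2
  simp only at this
  linarith

lemma exists_isBubbleThreshold (hc : CompositeAssumption c) {G : ℝ} (hG : 0 < G) :
    ∃ wb, IsBubbleThreshold c G wb := by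
  obtain ⟨k₁, h1, h1'⟩ := hc.exists_mrs_lt hG
  obtain ⟨k₂, h2', h2⟩ := ((hc.tendsto_mrs_atTop.eventually (eventually_gt_atTop G)).and
    (eventually_ge_atTop k₁)).exists
  have hcont : ContinuousOn (mrs c) (Icc k₁ k₂) := fun k hk =>
    ContinuousAt.continuousWithinAt (hc.tendsto_mrs tendsto_id (h1.trans_le hk.1))
  obtain ⟨k, hk, hk'⟩ := intermediate_value_Icc h2 hcont ⟨h1'.le, h2'.le⟩
  refine ⟨k / G, div_pos (h1.trans_le hk.1) hG, ?_⟩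
  rw [mul_div_cancel₀ _ hG.ne']
  exact hk'

end CompositeAssumption

lemma IsBubbleThreshold.unique (hc : CompositeAssumption c) {G w w' : ℝ} (hG : 0 < G)
    (h : IsBubbleThreshold c G w) (h' : IsBubbleThreshold c G w') : w' = w :=
  mul_left_cancel₀ hG.ne' (hc.strictMonoOn_mrs.injOn (mem_Ioi.2 (mul_pos hG h'.1))
    (mem_Ioi.2 (mul_pos hG h.1)) (h'.2.trans h.2.symm))

/-! ### Utility -/

section Utility

variable {E : Economy} {v : ℝ → ℝ} {γ : ℝ}

lemma strictMonoOn_crra (hγ : γ < 1) : StrictMonoOn (crra γ) (Ioi 0) := by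
  intro x hx y _ hxy
  rw [crra, crra, if_neg hγ.ne, if_neg hγ.ne]
  have h : 0 < 1 - γ := by linarith
  exact (div_lt_div_iff_of_pos_right h).2 (Real.rpow_lt_rpow (le_of_lt hx) hxy h)

lemma hasDerivAt_crra (hγ : γ < 1) {x : ℝ} (hx : 0 < x) :
    HasDerivAt (crra γ) (x ^ (-γ)) x := by
  have h : 1 - γ ≠ 0 := by linarith
  have e : crra γ = fun x => x ^ (1 - γ) / (1 - γ) := by
    funext x
    rw [crra, if_neg hγ.ne]
  rw [e]
  refine ((Real.hasDerivAt_rpow_const (p := 1 - γ) (Or.inl hx.ne')).div_const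
    (1 - γ)).congr_deriv ?_
  rw [mul_div_cancel_left₀ _ h]
  congr 1
  ring

namespace UtilityAssumption

lemma strictMonoOn_v (hU : UtilityAssumption E c γ v) : StrictMonoOn v (Ioi 0) := by
  refine strictMonoOn_of_deriv_pos (convex_Ioi 0) hU.v_contDiff.continuousOn fun k hk => ?_
  rw [interior_Ioi] at hk
  exact hU.v_deriv_pos k hk

lemma le_iff (hU : UtilityAssumption E c γ v) (hc : CompositeAssumption c) (hγ : γ < 1)
    {y z y' z' k : ℝ} (hy : 0 < y) (hz : 0 < z) (hy' : 0 < y') (hz' : 0 < z') (hk : 0 < k) :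
    E.U y z k ≤ E.U y' z' k ↔ c y z ≤ c y' z' := by
  rw [hU.separable y z k hy hz hk, hU.separable y' z' k hy' hz' hk, add_le_add_iff_right]
  exact (strictMonoOn_crra hγ).le_iff_le (hc.pos y z hy hz) (hc.pos y' z' hy' hz')

lemma lt_iff (hU : UtilityAssumption E c γ v) (hc : CompositeAssumption c) (hγ : γ < 1)
    {y z y' z' k : ℝ} (hy : 0 < y) (hz : 0 < z) (hy' : 0 < y') (hz' : 0 < z') (hk : 0 < k) :
    E.U y z k < E.U y' z' k ↔ c y z < c y' z' := by
  rw [← not_le, ← not_le, hU.le_iff hc hγ hy' hz' hy hz hk]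

lemma strictMono_housing (hU : UtilityAssumption E c γ v) {y z k k' : ℝ} (hy : 0 < y)
    (hz : 0 < z) (hk : 0 < k) (h : k < k') : E.U y z k < E.U y z k' := by
  rw [hU.separable y z k hy hz hk, hU.separable y z k' hy hz (hk.trans h)]
  have := hU.strictMonoOn_v hk (hk.trans h) h
  linarith

end UtilityAssumption

end Utility

/-! ### First-order conditions in equilibrium -/

lemma eventually_pos_affine {a b : ℝ} (ha : 0 < a) : ∀ᶠ ε : ℝ in 𝓝 0, 0 < a + b * ε := by
  have h : Tendsto (fun ε : ℝ => a + b * ε) (𝓝 0) (𝓝 (a + b * 0)) :=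
    tendsto_const_nhds.add (tendsto_id.const_mul b)
  refine h.eventually (lt_mem_nhds ?_)
  simpa using ha

namespace IsEquilibrium

variable {E : Economy} {p : MarketPath} {v : ℝ → ℝ} {γ : ℝ}

lemma cy_pos (hp : IsEquilibrium E p) (t : ℕ) : 0 < p.cy t := (hp.affordable t).1

lemma co_succ_pos (hp : IsEquilibrium E p) (t : ℕ) : 0 < p.co (t + 1) := (hp.affordable t).2.1

lemma budget_young (hp : IsEquilibrium E p) (t : ℕ) : p.cy t + p.P t + p.r t ≤ E.ey t := by
  have h := (hp.affordable t).2.2.2.1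
  rwa [hp.rental_clears, hp.housing_clears, mul_one, mul_one] at h

lemma budget_old (hp : IsEquilibrium E p) (t : ℕ) :
    p.co (t + 1) ≤ E.eo (t + 1) + p.P (t + 1) + p.r (t + 1) := by
  have h := (hp.affordable t).2.2.2.2
  rwa [hp.housing_clears, mul_one, ← add_assoc] at h

lemma utility_le (hp : IsEquilibrium E p) {t : ℕ} {y z k a : ℝ} (h : InBudget E p t y z k a) :
    E.U y z k ≤ E.U (p.cy t) (p.co (t + 1)) 1 := by
  have := hp.optimal t y z k a h
  rwa [hp.rental_clears] at this

/-- No affordable plan with one unit of housing service has higher composite consumption. -/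
lemma composite_le (hp : IsEquilibrium E p) (hU : UtilityAssumption E c γ v)
    (hc : CompositeAssumption c) (hγ : γ < 1) {t : ℕ} {y z a : ℝ}
    (h : InBudget E p t y z 1 a) : c y z ≤ c (p.cy t) (p.co (t + 1)) :=
  (hU.le_iff hc hγ h.1 h.2.1 (hp.cy_pos t) (hp.co_succ_pos t) one_pos).1 (hp.utility_le h)

lemma rent_pos (hp : IsEquilibrium E p) (hU : UtilityAssumption E c γ v) (t : ℕ) :
    0 < p.r t := by
  refine (hp.rent_nonneg t).lt_of_ne' fun h0 => ?_
  have h1 := hp.budget_young t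
  have h2 := hp.budget_old t
  have h := hp.utility_le (t := t) (y := p.cy t) (z := p.co (t + 1)) (k := 2) (a := 1)
    ⟨hp.cy_pos t, hp.co_succ_pos t, two_pos, by rw [h0] at h1 ⊢; linarith, by linarith⟩
  exact absurd (hU.strictMono_housing (hp.cy_pos t) (hp.co_succ_pos t) one_pos one_lt_two)
    h.not_gt

lemma S_pos (hp : IsEquilibrium E p) (hU : UtilityAssumption E c γ v) (t : ℕ) : 0 < p.S t :=
  add_pos_of_nonneg_of_pos (hp.price_nonneg t) (hp.rent_pos hU t)

lemma cy_eq (hp : IsEquilibrium E p) (hU : UtilityAssumption E c γ v)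
    (hc : CompositeAssumption c) (hγ : γ < 1) (t : ℕ) : p.cy t = E.ey t - p.S t := by
  have h1 := hp.budget_young t
  have h2 := hp.budget_old t
  rw [MarketPath.S]
  by_contra hne
  have hlt : p.cy t < E.ey t - (p.P t + p.r t) := lt_of_le_of_ne (by linarith) hne
  have h := hp.composite_le hU hc hγ (t := t) (y := E.ey t - (p.P t + p.r t))
    (z := p.co (t + 1)) (a := 1)
    ⟨(hp.cy_pos t).trans hlt, hp.co_succ_pos t, one_pos, by linarith, by linarith⟩
  exact absurd (hc.strictMonoOn_fst (hp.co_succ_pos t) (hp.cy_pos t)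
    ((hp.cy_pos t).trans hlt) hlt) h.not_gt

lemma co_eq (hp : IsEquilibrium E p) (hU : UtilityAssumption E c γ v)
    (hc : CompositeAssumption c) (hγ : γ < 1) (t : ℕ) : p.co t = E.eo t + p.S t := by
  have h := hp.commodity_clears t
  rw [hp.cy_eq hU hc hγ t] at h
  linarith

lemma co_pos (hp : IsEquilibrium E p) (hU : UtilityAssumption E c γ v)
    (hc : CompositeAssumption c) (hγ : γ < 1) (t : ℕ) : 0 < p.co t := by
  rw [hp.co_eq hU hc hγ]
  exact add_pos (E.eo_pos t) (hp.S_pos hU t)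

lemma price_pos (hp : IsEquilibrium E p) (hU : UtilityAssumption E c γ v)
    (hc : CompositeAssumption c) (hγ : γ < 1) (t : ℕ) : 0 < p.P t := by
  refine (hp.price_nonneg t).lt_of_ne' fun h0 => ?_
  have h1 := hp.budget_young t
  have h2 := hp.budget_old t
  have hS := hp.S_pos hU (t + 1)
  rw [MarketPath.S] at hS
  have hz := hp.co_succ_pos t
  have hlt : p.co (t + 1) < p.co (t + 1) + (p.P (t + 1) + p.r (t + 1)) := by linarith
  have h := hp.composite_le hU hc hγ (t := t) (y := p.cy t)
    (z := p.co (t + 1) + (p.P (t + 1) + p.r (t + 1))) (a := 2)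
    ⟨hp.cy_pos t, hz.trans hlt, one_pos, by rw [h0] at h1 ⊢; linarith, by linarith⟩
  exact absurd (hc.strictMonoOn_snd (hp.cy_pos t) hz (hz.trans hlt) hlt) h.not_gt

/-- First-order condition for the demand for the housing stock. -/
lemma foc_stock (hp : IsEquilibrium E p) (hU : UtilityAssumption E c γ v)
    (hc : CompositeAssumption c) (hγ : γ < 1) (t : ℕ) :
    p.P t * dy c (p.cy t) (p.co (t + 1)) = p.S (t + 1) * dz c (p.cy t) (p.co (t + 1)) := by
  have hy := hp.cy_pos t
  have hz := hp.co_succ_pos t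
  have h1 := hp.budget_young t
  have h2 := hp.budget_old t
  have ha : HasDerivAt (fun ε : ℝ => p.cy t + -p.P t * ε) (-p.P t) 0 := by
    simpa using ((hasDerivAt_id (0 : ℝ)).const_mul (-p.P t)).const_add (p.cy t)
  have hb : HasDerivAt (fun ε : ℝ => p.co (t + 1) + p.S (t + 1) * ε) (p.S (t + 1)) 0 := by
    simpa using ((hasDerivAt_id (0 : ℝ)).const_mul (p.S (t + 1))).const_add (p.co (t + 1))
  have hd := hc.hasDerivAt_comp ha hb (by simpa using hy) (by simpa using hz)
  have hmax : IsLocalMax (fun ε : ℝ => c (p.cy t + -p.P t * ε)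
      (p.co (t + 1) + p.S (t + 1) * ε)) 0 := by
    filter_upwards [eventually_pos_affine (b := -p.P t) hy,
      eventually_pos_affine (b := p.S (t + 1)) hz] with ε e1 e2
    simp only [mul_zero, add_zero]
    refine hp.composite_le hU hc hγ (a := 1 + ε) ⟨e1, e2, one_pos, by linarith, ?_⟩
    rw [MarketPath.S]
    linarith
  have h := hmax.hasDerivAt_eq_zero hd
  simp only [mul_zero, add_zero] at h
  linarith

/-- First-order condition for rented housing service. -/
lemma foc_rent (hp : IsEquilibrium E p) (hU : UtilityAssumption E c γ v)
    (hc : CompositeAssumption c) (hγ : γ < 1) (t : ℕ) :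
    p.r t * dy c (p.cy t) (p.co (t + 1)) = deriv v 1 * c (p.cy t) (p.co (t + 1)) ^ γ := by
  have hy := hp.cy_pos t
  have hz := hp.co_succ_pos t
  have h1 := hp.budget_young t
  have h2 := hp.budget_old t
  have hcpos := hc.pos _ _ hy hz
  have ha : HasDerivAt (fun ε : ℝ => p.cy t + -p.r t * ε) (-p.r t) 0 := by
    simpa using ((hasDerivAt_id (0 : ℝ)).const_mul (-p.r t)).const_add (p.cy t)
  have hd := hc.hasDerivAt_comp ha (hasDerivAt_const 0 (p.co (t + 1))) (by simpa using hy) hz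
  have hv : HasDerivAt (fun ε : ℝ => v (1 + 1 * ε)) (deriv v 1) 0 := by
    have hv1 : HasDerivAt v (deriv v 1) (1 + 1 * 0) := by
      simpa using ((hU.v_contDiff.differentiableOn (by norm_num)).differentiableAt
        (Ioi_mem_nhds one_pos)).hasDerivAt
    have hi : HasDerivAt (fun ε : ℝ => 1 + 1 * ε) (1 : ℝ) 0 := by
      simpa using ((hasDerivAt_id (0 : ℝ)).const_mul (1 : ℝ)).const_add (1 : ℝ)
    exact (hv1.comp (0 : ℝ) hi).congr_deriv (mul_one _)
  have hu := ((hasDerivAt_crra hγ (x := c (p.cy t + -p.r t * 0) (p.co (t + 1)))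
    (by simpa using hcpos)).comp (0 : ℝ) hd).add hv
  have hmax : IsLocalMax ((crra γ ∘ fun ε : ℝ => c (p.cy t + -p.r t * ε) (p.co (t + 1))) +
      fun ε : ℝ => v (1 + 1 * ε)) 0 := by
    filter_upwards [eventually_pos_affine (b := -p.r t) hy,
      eventually_pos_affine (b := 1) one_pos] with ε e1 e2
    simp only [Pi.add_apply, Function.comp_apply, mul_zero, add_zero]
    rw [← hU.separable _ _ _ e1 hz e2, ← hU.separable _ _ _ hy hz one_pos]
    exact hp.utility_le (a := 1) ⟨e1, hz, e2, by linarith, by linarith⟩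
  have h := hmax.hasDerivAt_eq_zero hu
  simp only [mul_zero, add_zero, zero_mul] at h
  rw [Real.rpow_neg hcpos.le] at h
  have hne : c (p.cy t) (p.co (t + 1)) ^ γ ≠ 0 := (Real.rpow_pos_of_pos hcpos γ).ne'
  field_simp at h
  linarith

lemma R_pos (hp : IsEquilibrium E p) (hU : UtilityAssumption E c γ v)
    (hc : CompositeAssumption c) (hγ : γ < 1) (t : ℕ) : 0 < p.R t :=
  div_pos (hp.S_pos hU (t + 1)) (hp.price_pos hU hc hγ t)

lemma R_mul_dz (hp : IsEquilibrium E p) (hU : UtilityAssumption E c γ v)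
    (hc : CompositeAssumption c) (hγ : γ < 1) (t : ℕ) :
    p.R t * dz c (p.cy t) (p.co (t + 1)) = dy c (p.cy t) (p.co (t + 1)) := by
  have h := hp.foc_stock hU hc hγ t
  have hP := (hp.price_pos hU hc hγ t).ne'
  rw [MarketPath.S] at h
  rw [MarketPath.R, div_mul_eq_mul_div, div_eq_iff hP]
  linarith

lemma R_eq_mrs (hp : IsEquilibrium E p) (hU : UtilityAssumption E c γ v)
    (hc : CompositeAssumption c) (hγ : γ < 1) (t : ℕ) :
    p.R t = mrs c (p.co (t + 1) / p.cy t) := by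
  rw [hc.mrs_ratio (hp.cy_pos t) (hp.co_succ_pos t),
    eq_div_iff (hc.dz_pos _ _ (hp.cy_pos t) (hp.co_succ_pos t)).ne', hp.R_mul_dz hU hc hγ]

lemma q_pos (hp : IsEquilibrium E p) (hU : UtilityAssumption E c γ v)
    (hc : CompositeAssumption c) (hγ : γ < 1) (t : ℕ) : 0 < p.q t :=
  one_div_pos.2 (Finset.prod_pos fun s _ => hp.R_pos hU hc hγ s)

lemma q_succ_mul_R (hp : IsEquilibrium E p) (hU : UtilityAssumption E c γ v)
    (hc : CompositeAssumption c) (hγ : γ < 1) (t : ℕ) : p.q (t + 1) * p.R t = p.q t := by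
  have h := (hp.R_pos hU hc hγ t).ne'
  have h' := (Finset.prod_pos fun s (_ : s ∈ Finset.range t) => hp.R_pos hU hc hγ s).ne'
  rw [MarketPath.q, MarketPath.q, Finset.prod_range_succ]
  field_simp

/-- The return on the housing stock is the interest rate: no arbitrage. -/
lemma q_succ_mul_S (hp : IsEquilibrium E p) (hU : UtilityAssumption E c γ v)
    (hc : CompositeAssumption c) (hγ : γ < 1) (t : ℕ) :
    p.q (t + 1) * p.S (t + 1) = p.q t * p.P t := by
  rw [← hp.q_succ_mul_R hU hc hγ t, MarketPath.R, MarketPath.S, mul_assoc,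
    div_mul_cancel₀ _ (hp.price_pos hU hc hγ t).ne']

end IsEquilibrium

/-! ### The detrended economy -/

/-- Housing expenditure as a share of the income `e₁ * G ^ t` of the young, the first component of
`auxVar`. -/
noncomputable def share (G e₁ : ℝ) (p : MarketPath) (t : ℕ) : ℝ := p.S t / (e₁ * G ^ t)

variable {E : Economy} {p : MarketPath} {v : ℝ → ℝ} {γ G e₁ e₂ : ℝ}

lemma EndowmentAssumption.trend_pos (hG : EndowmentAssumption E G e₁ e₂) (t : ℕ) :
    0 < e₁ * G ^ t :=
  mul_pos hG.young_pos (pow_pos (zero_lt_one.trans hG.one_lt) t)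

lemma EndowmentAssumption.ratio_pos (hG : EndowmentAssumption E G e₁ e₂) : 0 < e₂ / e₁ :=
  div_pos hG.old_pos hG.young_pos

namespace IsEquilibrium

lemma share_pos (hp : IsEquilibrium E p) (hG : EndowmentAssumption E G e₁ e₂)
    (hU : UtilityAssumption E c γ v) (t : ℕ) : 0 < share G e₁ p t :=
  div_pos (hp.S_pos hU t) (hG.trend_pos t)

lemma eventually_detrended (hp : IsEquilibrium E p) (hG : EndowmentAssumption E G e₁ e₂)
    (hU : UtilityAssumption E c γ v) (hc : CompositeAssumption c) (hγ : γ < 1) :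
    ∀ᶠ t in atTop, share G e₁ p t < 1 ∧ p.cy t = e₁ * G ^ t * (1 - share G e₁ p t) ∧
      p.co (t + 1) = e₁ * G ^ t * (G * (e₂ / e₁ + share G e₁ p (t + 1))) := by
  obtain ⟨T, -, hT⟩ := hG.eventually_eq
  have he := hG.young_pos.ne'
  filter_upwards [eventually_ge_atTop T] with t ht
  have h1 : p.cy t = e₁ * G ^ t * (1 - share G e₁ p t) := by
    rw [hp.cy_eq hU hc hγ, (hT t ht).1, share, mul_sub, mul_one,
      mul_div_cancel₀ _ (hG.trend_pos t).ne']
  refine ⟨?_, h1, ?_⟩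
  · have h2 := hp.cy_pos t
    rw [h1] at h2
    linarith [(mul_pos_iff_of_pos_left (hG.trend_pos t)).1 h2]
  · have h3 : e₁ * G ^ (t + 1) * share G e₁ p (t + 1) = p.S (t + 1) :=
      mul_div_cancel₀ _ (hG.trend_pos (t + 1)).ne'
    rw [hp.co_eq hU hc hγ, (hT (t + 1) (by omega)).2, ← h3, pow_succ]
    field_simp

lemma eventually_R_eq (hp : IsEquilibrium E p) (hG : EndowmentAssumption E G e₁ e₂)
    (hU : UtilityAssumption E c γ v) (hc : CompositeAssumption c) (hγ : γ < 1) :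
    ∀ᶠ t in atTop, p.R t =
      mrs c (G * (e₂ / e₁ + share G e₁ p (t + 1)) / (1 - share G e₁ p t)) := by
  filter_upwards [hp.eventually_detrended hG hU hc hγ] with t ⟨_, h1, h2⟩
  rw [hp.R_eq_mrs hU hc hγ, h1, h2, mul_div_mul_left _ _ (hG.trend_pos t).ne']

/-! ### Present value of the gains of a dominating allocation -/

lemma composite_le_of_genUtility_le (hp : IsEquilibrium E p) (hU : UtilityAssumption E c γ v)
    (hc : CompositeAssumption c) (hγ : γ < 1) {b : Allocation} (hb : Feasible E b) {t : ℕ}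
    (h : genUtility E p.toAllocation t ≤ genUtility E b t) :
    c (p.cy t) (p.co (t + 1)) ≤ c (b.cy t) (b.co (t + 1)) ∧
      (genUtility E p.toAllocation t < genUtility E b t →
        c (p.cy t) (p.co (t + 1)) < c (b.cy t) (b.co (t + 1))) := by
  obtain ⟨hby, -, hbh, hbh1, -⟩ := hb t
  have hbz := (hb (t + 1)).2.1
  have hle : genUtility E b t ≤ E.U (b.cy t) (b.co (t + 1)) 1 := by
    rcases hbh1.eq_or_lt with h1 | h1
    · rw [genUtility, h1]
    · exact (hU.strictMono_housing hby hbz hbh h1).le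
  have hpe : genUtility E p.toAllocation t = E.U (p.cy t) (p.co (t + 1)) 1 := by
    rw [genUtility, hp.rental_clears]
  rw [← hU.le_iff hc hγ (hp.cy_pos t) (hp.co_succ_pos t) hby hbz one_pos,
    ← hU.lt_iff hc hγ (hp.cy_pos t) (hp.co_succ_pos t) hby hbz one_pos, ← hpe]
  exact ⟨h.trans hle, fun h' => h'.trans_le hle⟩

lemma gain_succ_sub (hp : IsEquilibrium E p) (hU : UtilityAssumption E c γ v)
    (hc : CompositeAssumption c) (hγ : γ < 1) {b : Allocation} (hb : Feasible E b) (t : ℕ) :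
    p.q (t + 1) / dz c (p.cy t) (p.co (t + 1)) *
        (c (b.cy t) (b.co (t + 1)) - c (p.cy t) (p.co (t + 1))) ≤
      p.q (t + 1) * (b.co (t + 1) - p.co (t + 1)) - p.q t * (b.co t - p.co t) := by
  have hy := hp.cy_pos t
  have hz := hp.co_succ_pos t
  have hdz := hc.dz_pos _ _ hy hz
  have hq := hp.q_pos hU hc hγ (t + 1)
  have h1 := hc.le_tangent hy hz (hb t).1 (hb (t + 1)).2.1
  have h2 := hc.euler hy hz
  have h3 : b.cy t = p.cy t - (b.co t - p.co t) := by
    linarith [(hb t).2.2.2.2, hp.commodity_clears t]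
  rw [← hp.R_mul_dz hU hc hγ, h3] at h1
  rw [← hp.R_mul_dz hU hc hγ] at h2
  rw [← hp.q_succ_mul_R hU hc hγ t, div_mul_eq_mul_div, div_le_iff₀ hdz]
  rw [h3]
  have h4 := mul_le_mul_of_nonneg_left (sub_le_sub_right h1 (c (p.cy t) (p.co (t + 1)))) hq.le
  refine h4.trans_eq ?_
  rw [← h2]
  ring

/-- Under a dominating allocation the generation born at `t` gives up `b.co t - p.co t` when young
and receives `b.co (t + 1) - p.co (t + 1)` when old. Its marginal rate of substitution is the
interest rate, so not to be worse off it must receive at least the same present value, and strictly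
more to be better off. Hence the present value of the gain of the old never falls, and it becomes
positive. -/
lemma gain_monotone (hp : IsEquilibrium E p) (hU : UtilityAssumption E c γ v)
    (hc : CompositeAssumption c) (hγ : γ < 1) {b : Allocation} (hb : Feasible E b)
    (hd : Dominates E b p.toAllocation) :
    Monotone (fun t => p.q t * (b.co t - p.co t)) ∧
      ∃ D > 0, ∀ᶠ t in atTop, D ≤ p.q t * (b.co t - p.co t) := by
  have hw : ∀ t, 0 < p.q (t + 1) / dz c (p.cy t) (p.co (t + 1)) := fun t =>
    div_pos (hp.q_pos hU hc hγ _) (hc.dz_pos _ _ (hp.cy_pos t) (hp.co_succ_pos t))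
  have hmono : Monotone (fun t => p.q t * (b.co t - p.co t)) := by
    refine monotone_nat_of_le_succ fun t => ?_
    have h1 := hp.gain_succ_sub hU hc hγ hb t
    have h2 := (hp.composite_le_of_genUtility_le hU hc hγ hb (hd.2.1 t)).1
    linarith [mul_nonneg (hw t).le (sub_nonneg.2 h2)]
  have h0 : 0 ≤ p.q 0 * (b.co 0 - p.co 0) :=
    mul_nonneg (hp.q_pos hU hc hγ 0).le (sub_nonneg.2 hd.1)
  refine ⟨hmono, ?_⟩
  obtain ⟨n, hn⟩ : ∃ n, 0 < p.q n * (b.co n - p.co n) := by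
    rcases hd.2.2 with h | ⟨t, ht⟩
    · exact ⟨0, mul_pos (hp.q_pos hU hc hγ 0) (sub_pos.2 h)⟩
    · refine ⟨t + 1, ?_⟩
      have h1 := hp.gain_succ_sub hU hc hγ hb t
      have h2 := (hp.composite_le_of_genUtility_le hU hc hγ hb (hd.2.1 t)).2 ht
      have h3 := hmono (Nat.zero_le t)
      simp only at h3
      linarith [mul_pos (hw t) (sub_pos.2 h2)]
  exact ⟨_, hn, eventually_atTop.2 ⟨n, fun t ht => hmono ht⟩⟩

/-! ### A sufficient condition for efficiency -/

/-- If the marginal rate of substitution at a stationary allocation is the growth factor, then a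
stationary transfer from the young to the old lowers composite consumption. The transferred
allocation is written as a limit point: its young may consume nothing, so composite consumption
there is replaced by its bound from the tangent plane at half the transfer. -/
lemma exists_tangent_lt (hc : CompositeAssumption c) {w x δ : ℝ} (hG : 0 < G) (hw : 0 < w)
    (hx0 : 0 ≤ x) (hδ : 0 < δ) (hδx : δ ≤ 1 - x) (hm : mrs c (G * (w + x) / (1 - x)) = G) :
    ∃ a₁ a₂ : ℝ, (∀ y z, 0 < y → 0 < z → c y z ≤ a₁ * y + a₂ * z) ∧
      a₁ * (1 - x - δ) + a₂ * (G * (w + x + δ)) < c (1 - x) (G * (w + x)) := by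
  have hy : 0 < 1 - x := by linarith
  have hz : 0 < G * (w + x) := by positivity
  have hy' : 0 < 1 - x - δ / 2 := by linarith
  have hz' : 0 < G * (w + x + δ / 2) := by positivity
  refine ⟨dy c (1 - x - δ / 2) (G * (w + x + δ / 2)),
    dz c (1 - x - δ / 2) (G * (w + x + δ / 2)), fun y z h1 h2 => hc.le_tangent hy' hz' h1 h2, ?_⟩
  rw [hc.mrs_ratio hy hz, div_eq_iff (hc.dz_pos _ _ hy hz).ne'] at hm
  have h1 := hc.le_tangent hy hz hy' hz'
  have h2 := hc.euler hy hz
  have h3 := hc.euler hy' hz'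
  have h4 := hc.lt_tangent hy' hz' hy hz (ne_of_gt (by
    have : 0 < G * (δ / 2) * (1 + w) := by positivity
    linarith))
  rw [hm] at h1 h2
  linarith

/-- An equilibrium is efficient if the present value of trend income tends to zero, or if it
converges and the equilibrium converges to a stationary allocation whose interest rate is the
growth factor. -/
lemma paretoEfficient_of_tendsto (hp : IsEquilibrium E p) (hG : EndowmentAssumption E G e₁ e₂)
    (hU : UtilityAssumption E c γ v) (hc : CompositeAssumption c) (hγ : γ < 1) {Q : ℝ}
    (hQ : Tendsto (fun t => p.q t * G ^ t) atTop (𝓝 Q))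
    (hx : Q ≠ 0 → ∃ x, 0 ≤ x ∧ Tendsto (share G e₁ p) atTop (𝓝 x) ∧ x < 1 ∧
      mrs c (G * (e₂ / e₁ + x) / (1 - x)) = G) :
    ParetoEfficient E p.toAllocation := by
  rintro ⟨b, hb, hd⟩
  obtain ⟨hmono, D, hD, hDle⟩ := hp.gain_monotone hU hc hγ hb hd
  have he := hG.young_pos
  have hG0 : 0 < G := zero_lt_one.trans hG.one_lt
  have hw := hG.ratio_pos
  have hby : ∀ t, b.cy t = p.cy t - (b.co t - p.co t) := fun t => by
    linarith [(hb t).2.2.2.2, hp.commodity_clears t]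
  -- `δ t` is the gain of the old as a share of trend income
  set δ : ℕ → ℝ := fun t => (b.co t - p.co t) / (e₁ * G ^ t)
  have hδ : ∀ t, b.co t - p.co t = e₁ * G ^ t * δ t := fun t =>
    (mul_div_cancel₀ _ (hG.trend_pos t).ne').symm
  have hδlt : ∀ᶠ t in atTop, δ t < 1 - share G e₁ p t := by
    filter_upwards [hp.eventually_detrended hG hU hc hγ] with t ⟨_, h1, _⟩
    have h2 := (hb t).1
    rw [hby, hδ, h1, ← mul_sub] at h2
    linarith [(mul_pos_iff_of_pos_left (hG.trend_pos t)).1 h2]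
  have hub : ∀ᶠ t in atTop, p.q t * (b.co t - p.co t) ≤ e₁ * (p.q t * G ^ t) := by
    filter_upwards [hδlt] with t ht
    have h1 := mul_pos (hp.q_pos hU hc hγ t) (hG.trend_pos t)
    have h2 := mul_le_mul_of_nonneg_left (ht.le.trans
      (sub_le_self 1 (hp.share_pos hG hU t).le)) h1.le
    rw [hδ]
    linarith
  have hQe := hQ.const_mul e₁
  have hQpos : 0 < Q := by
    have h := ge_of_tendsto hQe (by filter_upwards [hDle, hub] with t h1 h2; exact h1.trans h2)
    exact (mul_pos_iff_of_pos_left he).1 (hD.trans_le h)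
  obtain ⟨L, hL⟩ : ∃ L, Tendsto (fun t => p.q t * (b.co t - p.co t)) atTop (𝓝 L) :=
    (tendsto_atTop_of_monotone hmono).resolve_left fun h =>
      not_tendsto_nhds_of_tendsto_atTop (tendsto_atTop_mono' atTop hub h) _ hQe
  have hLpos : 0 < L := hD.trans_le (ge_of_tendsto hL hDle)
  have hδlim : Tendsto δ atTop (𝓝 (L / (e₁ * Q))) := by
    refine (hL.div hQe (mul_pos he hQpos).ne').congr fun t => ?_
    have := (hp.q_pos hU hc hγ t).ne'
    simp only [Pi.div_apply]
    rw [hδ]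
    field_simp
  obtain ⟨x, hx0, hxlim, hx1, hm⟩ := hx hQpos.ne'
  have hδpos : 0 < L / (e₁ * Q) := div_pos hLpos (mul_pos he hQpos)
  have hδle : L / (e₁ * Q) ≤ 1 - x :=
    le_of_tendsto_of_tendsto hδlim (tendsto_const_nhds.sub hxlim) (hδlt.mono fun _ h => h.le)
  obtain ⟨a₁, a₂, htan, hlt⟩ := exists_tangent_lt hc hG0 hw hx0 hδpos hδle hm
  refine hlt.not_ge ?_
  have hxlim' := (tendsto_add_atTop_iff_nat 1).2 hxlim
  have hδlim' := (tendsto_add_atTop_iff_nat 1).2 hδlim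
  have hx1' : Tendsto (fun t => 1 - share G e₁ p t) atTop (𝓝 (1 - x)) :=
    tendsto_const_nhds.sub hxlim
  have hx2' : Tendsto (fun t => e₂ / e₁ + share G e₁ p (t + 1)) atTop (𝓝 (e₂ / e₁ + x)) :=
    tendsto_const_nhds.add hxlim'
  refine le_of_tendsto_of_tendsto
    (hc.tendsto_comp hx1' (hx2'.const_mul G) (by linarith) (by positivity))
    (((hx1'.sub hδlim).const_mul a₁).add (((hx2'.add hδlim').const_mul G).const_mul a₂)) ?_
  filter_upwards [hp.eventually_detrended hG hU hc hγ] with t ⟨hs, h1, h2⟩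
  have htr := hG.trend_pos t
  have hs' := hp.share_pos hG hU (t + 1)
  have hle := (hp.composite_le_of_genUtility_le hU hc hγ hb (hd.2.1 t)).1
  have e1 : b.cy t = e₁ * G ^ t * (1 - share G e₁ p t - δ t) := by
    rw [hby, hδ, h1]
    ring
  have e2 : b.co (t + 1) = e₁ * G ^ t * (G * (e₂ / e₁ + share G e₁ p (t + 1) + δ (t + 1))) := by
    have h3 := hδ (t + 1)
    rw [h2] at h3
    rw [pow_succ] at h3
    linear_combination h3
  have p1 := (hb t).1
  have p2 := (hb (t + 1)).2.1
  rw [e1] at p1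
  rw [e2] at p2
  replace p1 := (mul_pos_iff_of_pos_left htr).1 p1
  replace p2 := (mul_pos_iff_of_pos_left htr).1 p2
  rw [h1, h2, e1, e2, hc.homogeneous _ _ _ htr (by linarith) (by positivity),
    hc.homogeneous _ _ _ htr p1 p2] at hle
  exact (le_of_mul_le_mul_left hle htr).trans (htan _ _ p1 p2)

end IsEquilibrium

namespace IsEquilibrium

/-! ### Efficiency above the threshold -/

/-- Above the threshold, trend income does not grow faster than the interest rate, so its present
value converges. If the limit is positive, interest rates converge to the growth factor, which
leaves no room for housing expenditure in the limit. -/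
lemma paretoEfficient_of_threshold_le (hp : IsEquilibrium E p)
    (hG : EndowmentAssumption E G e₁ e₂) (hU : UtilityAssumption E c γ v)
    (hc : CompositeAssumption c) (hγ : γ < 1) {wb : ℝ} (hwb : IsBubbleThreshold c G wb)
    (hw : wb ≤ e₂ / e₁) : ParetoEfficient E p.toAllocation := by
  have hG0 : 0 < G := zero_lt_one.trans hG.one_lt
  have hw0 := hG.ratio_pos
  have hmwb : mrs c (G * wb) = G := hwb.2
  have hR : ∀ᶠ t in atTop, mrs c (G * (e₂ / e₁ + share G e₁ p (t + 1))) ≤ p.R t := by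
    filter_upwards [hp.eventually_R_eq hG hU hc hγ, hp.eventually_detrended hG hU hc hγ]
      with t h1 ⟨h2, _⟩
    have hs := hp.share_pos hG hU t
    have hs' := hp.share_pos hG hU (t + 1)
    have hn : 0 < G * (e₂ / e₁ + share G e₁ p (t + 1)) := by positivity
    rw [h1]
    refine hc.strictMonoOn_mrs.monotoneOn hn (mem_Ioi.2 (div_pos hn (by linarith))) ?_
    rw [le_div_iff₀ (by linarith)]
    exact mul_le_of_le_one_right hn.le (by linarith)
  have hGR : ∀ᶠ t in atTop, G ≤ p.R t := by
    filter_upwards [hR] with t ht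
    refine le_trans ?_ ht
    have hs' := hp.share_pos hG hU (t + 1)
    nth_rewrite 1 [← hmwb]
    refine hc.strictMonoOn_mrs.monotoneOn (mem_Ioi.2 (mul_pos hG0 hwb.1))
      (mem_Ioi.2 (by positivity)) (mul_le_mul_of_nonneg_left (by linarith) hG0.le)
  have hqpos : ∀ t, 0 < p.q t * G ^ t := fun t =>
    mul_pos (hp.q_pos hU hc hγ t) (pow_pos hG0 t)
  obtain ⟨T, hT⟩ := eventually_atTop.1 hGR
  have hanti : Antitone (fun n => p.q (n + T) * G ^ (n + T)) := by
    refine antitone_nat_of_succ_le fun n => ?_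
    have h1 := hT (n + T) (by omega)
    have h2 := hp.q_succ_mul_R hU hc hγ (n + T)
    have h3 := hp.q_pos hU hc hγ (n + T + 1)
    rw [show n + 1 + T = n + T + 1 by omega, pow_succ, ← h2, mul_comm (G ^ (n + T)) G, ← mul_assoc]
    exact mul_le_mul_of_nonneg_right (mul_le_mul_of_nonneg_left h1 h3.le) (pow_pos hG0 _).le
  have hQ := (tendsto_add_atTop_iff_nat (f := fun t => p.q t * G ^ t) T).1
    (tendsto_atTop_ciInf hanti ⟨0, by rintro _ ⟨n, rfl⟩; exact (hqpos _).le⟩)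
  refine hp.paretoEfficient_of_tendsto hG hU hc hγ hQ fun hne => ?_
  have hRlim : Tendsto p.R atTop (𝓝 G) := by
    have h := (hQ.div ((tendsto_add_atTop_iff_nat 1).2 hQ) hne).const_mul G
    rw [div_self hne, mul_one] at h
    refine h.congr fun t => ?_
    have h1 := (hp.q_pos hU hc hγ (t + 1)).ne'
    simp only [Pi.div_apply]
    rw [← hp.q_succ_mul_R hU hc hγ t, pow_succ]
    field_simp
  have hslim : Tendsto (share G e₁ p) atTop (𝓝 0) := by
    rw [← tendsto_add_atTop_iff_nat 1]
    refine tendsto_order.2 ⟨fun a ha => Eventually.of_forall fun t =>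
      ha.trans (hp.share_pos hG hU (t + 1)), fun a ha => ?_⟩
    have hlt : G < mrs c (G * (wb + a)) := by
      nth_rewrite 1 [← hmwb]
      exact hc.strictMonoOn_mrs (mem_Ioi.2 (mul_pos hG0 hwb.1))
        (mem_Ioi.2 (mul_pos hG0 (by linarith [hwb.1])))
        (mul_lt_mul_of_pos_left (by linarith) hG0)
    filter_upwards [hR, hRlim.eventually (gt_mem_nhds hlt)] with t h1 h2
    by_contra hge
    rw [not_lt] at hge
    refine (h1.trans_lt h2).not_ge (hc.strictMonoOn_mrs.monotoneOn
      (mem_Ioi.2 (mul_pos hG0 (by linarith [hwb.1])))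
      (mem_Ioi.2 (mul_pos hG0 (by linarith [hwb.1])))
      (mul_le_mul_of_nonneg_left (by linarith) hG0.le))
  refine ⟨0, le_rfl, hslim, one_pos, ?_⟩
  have hsl' := (tendsto_add_atTop_iff_nat 1).2 hslim
  have hk := ((hsl'.const_add (e₂ / e₁)).const_mul G).div (hslim.const_sub 1) (by norm_num)
  have hm := hc.tendsto_mrs hk (div_pos (mul_pos hG0 (by linarith)) (by norm_num))
  exact tendsto_nhds_unique (hm.congr' ((hp.eventually_R_eq hG hU hc hγ).mono fun _ h => h.symm))
    hRlim

/-! ### Efficiency of bubbly long run equilibria -/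

end IsEquilibrium

/-- In a bubbly steady state the interest rate is the growth factor. -/
lemma IsBubblySteadyState.mrs_eq (hc : CompositeAssumption c) (hG : 1 < G) (hγ : γ < 1) {w m : ℝ}
    (hw : 0 < w) {ξ : ℝ × ℝ} (h : IsBubblySteadyState c γ G w m ξ) :
    mrs c (G * (w + ξ.1) / (1 - ξ.1)) = G := by
  obtain ⟨⟨-, h1, h2⟩, h0⟩ := h
  have hG0 : 0 < G := zero_lt_one.trans hG
  have hy : 0 < 1 - ξ.1 := by linarith
  have hz : 0 < G * (w + ξ.1) := by positivity
  have e1 := congrArg Prod.fst h2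
  have e2 := congrArg Prod.snd h2
  simp only [Phi, Prod.fst_zero, Prod.snd_zero] at e1 e2
  have hpow : G ^ (γ - 1) < 1 := Real.rpow_lt_one_of_one_lt_of_neg hG (by linarith)
  have hξ2 : ξ.2 = 0 := by
    have : (1 - G ^ (γ - 1)) * ξ.2 = 0 := by linarith
    exact (mul_eq_zero.1 this).resolve_left (by linarith)
  rw [hξ2, mul_zero, add_zero] at e1
  rw [hc.mrs_ratio hy hz, div_eq_iff (hc.dz_pos _ _ hy hz).ne']
  refine mul_left_cancel₀ h0.ne' ?_
  linarith

namespace IsEquilibrium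

lemma price_antitone (hp : IsEquilibrium E p) (hU : UtilityAssumption E c γ v)
    (hc : CompositeAssumption c) (hγ : γ < 1) : Antitone (fun t => p.q t * p.P t) := by
  refine antitone_nat_of_succ_le fun t => ?_
  rw [← hp.q_succ_mul_S hU hc hγ t, MarketPath.S]
  exact mul_le_mul_of_nonneg_left (by linarith [hp.rent_pos hU (t + 1)])
    (hp.q_pos hU hc hγ (t + 1)).le

/-- The present value of housing expenditure converges; where that expenditure is asymptotically a
positive share of trend income, so does the present value of trend income. -/
lemma paretoEfficient_of_bubbly (hp : IsEquilibrium E p) (hG : EndowmentAssumption E G e₁ e₂)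
    (hU : UtilityAssumption E c γ v) (hc : CompositeAssumption c) (hγ : γ < 1) {m : ℝ}
    {ξ : ℝ × ℝ} (hξ : IsBubblySteadyState c γ G (e₂ / e₁) m ξ)
    (hlim : Tendsto (share G e₁ p) atTop (𝓝 ξ.1)) : ParetoEfficient E p.toAllocation := by
  have he := hG.young_pos
  have hG0 : 0 < G := zero_lt_one.trans hG.one_lt
  have hanti := hp.price_antitone hU hc hγ
  have hS : Tendsto (fun t => p.q t * p.S t) atTop (𝓝 (⨅ t, p.q t * p.P t)) := by
    rw [← tendsto_add_atTop_iff_nat 1]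
    refine (tendsto_atTop_ciInf hanti ⟨0, ?_⟩).congr fun t => (hp.q_succ_mul_S hU hc hγ t).symm
    rintro _ ⟨t, rfl⟩
    exact (mul_pos (hp.q_pos hU hc hγ t) (hp.price_pos hU hc hγ t)).le
  have hQ := hS.div (hlim.const_mul e₁) (mul_pos he hξ.2).ne'
  refine hp.paretoEfficient_of_tendsto hG hU hc hγ (hQ.congr fun t => ?_) fun _ =>
    ⟨ξ.1, hξ.2.le, hlim, hξ.1.2.1, hξ.mrs_eq hc hG.one_lt hγ hG.ratio_pos⟩
  have hSt := (hp.S_pos hU t).ne'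
  have htr := (hG.trend_pos t).ne'
  simp only [Pi.div_apply, share]
  field_simp

/-! ### Inefficiency of fundamental long run equilibria -/

/-- Below the threshold, if housing expenditure vanishes relative to trend income, a constant share
of the income of the young can eventually be transferred to the old to the benefit of all. -/
lemma not_paretoEfficient_of_tendsto_zero (hp : IsEquilibrium E p)
    (hG : EndowmentAssumption E G e₁ e₂) (hU : UtilityAssumption E c γ v)
    (hc : CompositeAssumption c) (hγ : γ < 1) {wb : ℝ} (hwb : IsBubbleThreshold c G wb)
    (hw : e₂ / e₁ < wb) (hlim : Tendsto (share G e₁ p) atTop (𝓝 0)) :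
    ¬ ParetoEfficient E p.toAllocation := by
  have hG0 : 0 < G := zero_lt_one.trans hG.one_lt
  have hw0 := hG.ratio_pos
  have hwb0 := hwb.1
  set w := e₂ / e₁
  -- The share that moves the economy to the ratio `wb`, where the interest rate is `G`.
  obtain ⟨ε, hε, hε1, hεw⟩ : ∃ ε, 0 < ε ∧ 0 < 1 - ε ∧ w + ε = wb * (1 - ε) := by
    refine ⟨(wb - w) / (1 + wb), div_pos (by linarith) (by linarith), ?_, ?_⟩
    · rw [sub_pos, div_lt_one (by linarith)]
      linarith
    · field_simp
      ring
  have hz : 0 < G * (w + ε) := by positivity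
  have hlt : c 1 (G * w) < c (1 - ε) (G * (w + ε)) := by
    have hm : mrs c (G * (w + ε) / (1 - ε)) = G := by
      rw [hεw, ← mul_assoc, mul_div_cancel_right₀ _ hε1.ne']
      exact hwb.2
    rw [hc.mrs_ratio hε1 hz, div_eq_iff (hc.dz_pos _ _ hε1 hz).ne'] at hm
    have h1 := hc.lt_tangent hε1 hz one_pos (mul_pos hG0 hw0) (ne_of_gt (by
      have : 0 < G * ε * (1 + w) := by positivity
      linarith))
    have h2 := hc.euler hε1 hz
    rw [hm] at h1 h2
    linarith
  have hlim' := (tendsto_add_atTop_iff_nat 1).2 hlim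
  have hy1 : Tendsto (fun t => 1 - share G e₁ p t) atTop (𝓝 1) := by
    simpa using hlim.const_sub 1
  have hy2 : Tendsto (fun t => 1 - share G e₁ p t - ε) atTop (𝓝 (1 - ε)) := hy1.sub_const ε
  have hz1 : Tendsto (fun t => G * (w + share G e₁ p (t + 1))) atTop (𝓝 (G * w)) := by
    simpa using (hlim'.const_add w).const_mul G
  have hz2 : Tendsto (fun t => G * (w + share G e₁ p (t + 1) + ε)) atTop (𝓝 (G * (w + ε))) := by
    simpa using ((hlim'.const_add w).add_const ε).const_mul G
  obtain ⟨N, hN⟩ := eventually_atTop.1 ((hp.eventually_detrended hG hU hc hγ).and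
    (((hc.tendsto_comp hy1 hz1 one_pos (mul_pos hG0 hw0)).eventually_lt
      (hc.tendsto_comp hy2 hz2 hε1 hz) hlt).and (hy2.eventually (lt_mem_nhds hε1))))
  set d : ℕ → ℝ := fun t => if N ≤ t then e₁ * G ^ t * ε else 0 with hd
  have hd0 : ∀ t, 0 ≤ d t := fun t => by
    simp only [hd]
    split_ifs
    · exact (mul_pos (hG.trend_pos t) hε).le
    · exact le_rfl
  let b : Allocation := ⟨fun t => p.cy t - d t, fun t => p.co t + d t, fun _ => 1⟩
  have hby : ∀ t, 0 < b.cy t := fun t => by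
    by_cases ht : N ≤ t
    · obtain ⟨⟨_, h1, _⟩, _, h2⟩ := hN t ht
      have h3 : b.cy t = e₁ * G ^ t * (1 - share G e₁ p t - ε) := by
        simp only [b, hd, if_pos ht, h1]
        ring
      rw [h3]
      exact mul_pos (hG.trend_pos t) h2
    · simpa [b, hd, ht] using hp.cy_pos t
  have hb : Feasible E b := fun t => by
    refine ⟨hby t, add_pos_of_pos_of_nonneg (hp.co_pos hU hc hγ t) (hd0 t), one_pos, le_rfl, ?_⟩
    rw [← hp.commodity_clears t]
    simp only [b]
    ring
  have hbz : ∀ t, 0 < b.co (t + 1) := fun t => (hb (t + 1)).2.1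
  have hpg : ∀ t, genUtility E p.toAllocation t = E.U (p.cy t) (p.co (t + 1)) 1 := fun t => by
    rw [genUtility, hp.rental_clears]
  have hlate : ∀ t, N ≤ t → genUtility E p.toAllocation t < genUtility E b t := fun t ht => by
    obtain ⟨⟨hs, h1, h2⟩, h3, h4⟩ := hN t ht
    have hs' := hp.share_pos hG hU (t + 1)
    have htr := hG.trend_pos t
    rw [hpg, genUtility,
      hU.lt_iff hc hγ (hp.cy_pos t) (hp.co_succ_pos t) (hby t) (hbz t) one_pos]
    have e1 : b.cy t = e₁ * G ^ t * (1 - share G e₁ p t - ε) := by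
      simp only [b, hd, if_pos ht, h1]
      ring
    have e2 : b.co (t + 1) = e₁ * G ^ t * (G * (w + share G e₁ p (t + 1) + ε)) := by
      simp only [b, hd, if_pos (ht.trans (Nat.le_succ t)), h2]
      rw [pow_succ]
      ring
    rw [e1, e2, h1, h2, hc.homogeneous _ _ _ htr (by linarith) (by positivity),
      hc.homogeneous _ _ _ htr h4 (by positivity)]
    exact mul_lt_mul_of_pos_left h3 htr
  have hearly : ∀ t, t < N → genUtility E p.toAllocation t ≤ genUtility E b t := fun t ht => by
    rw [hpg, genUtility,
      hU.le_iff hc hγ (hp.cy_pos t) (hp.co_succ_pos t) (hby t) (hbz t) one_pos]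
    have e1 : b.cy t = p.cy t := by simp [b, hd, ht]
    rw [e1]
    exact (hc.strictMonoOn_snd (hp.cy_pos t)).monotoneOn (hp.co_succ_pos t) (hbz t)
      (le_add_of_nonneg_right (hd0 (t + 1)))
  exact fun h => h ⟨b, hb, le_add_of_nonneg_right (hd0 0),
    fun t => (lt_or_ge t N).elim (hearly t) fun h' => (hlate t h').le,
    Or.inr ⟨N, hlate N le_rfl⟩⟩

/-- Rents grow no faster than `G ^ (γ t)`: the marginal rate of substitution of consumption for
housing is homogeneous of degree `γ` in consumption. -/
lemma exists_rent_le (hp : IsEquilibrium E p) (hG : EndowmentAssumption E G e₁ e₂)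
    (hU : UtilityAssumption E c γ v) (hc : CompositeAssumption c) (hγ : γ < 1) :
    ∃ K, ∀ᶠ t in atTop, p.r t / (e₁ * G ^ t) ≤ K * (G ^ (γ - 1)) ^ t := by
  have hG0 : 0 < G := zero_lt_one.trans hG.one_lt
  have hw0 := hG.ratio_pos
  have he := hG.young_pos
  have hγ0 := hU.gamma_pos
  have hm := hU.v_deriv_pos 1 one_pos
  set w := e₂ / e₁
  have hk := hc.dy_pos 1 (G * w) one_pos (mul_pos hG0 hw0)
  refine ⟨deriv v 1 * c 1 (G * (w + 1)) ^ γ / dy c 1 (G * w) * e₁ ^ (γ - 1), ?_⟩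
  have hdet := hp.eventually_detrended hG hU hc hγ
  filter_upwards [hdet, (tendsto_add_atTop_nat 1).eventually hdet]
    with t ⟨h1, h2, h3⟩ ⟨h1', _⟩
  have hs := hp.share_pos hG hU t
  have hs' := hp.share_pos hG hU (t + 1)
  have htr := hG.trend_pos t
  have hy : 0 < 1 - share G e₁ p t := by linarith
  have hz : 0 < G * (w + share G e₁ p (t + 1)) := by positivity
  have hdy : dy c 1 (G * w) ≤
      dy c (1 - share G e₁ p t) (G * (w + share G e₁ p (t + 1))) := by
    have h := hc.dy_scale hy one_pos (div_pos hz hy)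
    rw [mul_one, mul_div_cancel₀ _ hy.ne'] at h
    rw [h]
    refine hc.strictMonoOn_dy_one.monotoneOn (mem_Ioi.2 (mul_pos hG0 hw0))
      (mem_Ioi.2 (div_pos hz hy)) ?_
    rw [le_div_iff₀ hy]
    calc G * w * (1 - share G e₁ p t) ≤ G * w :=
          mul_le_of_le_one_right (mul_pos hG0 hw0).le (by linarith)
      _ ≤ _ := mul_le_mul_of_nonneg_left (by linarith) hG0.le
  have hcle : c (1 - share G e₁ p t) (G * (w + share G e₁ p (t + 1))) ≤ c 1 (G * (w + 1)) :=
    ((hc.strictMonoOn_fst hz).monotoneOn hy (mem_Ioi.2 one_pos) (by linarith)).trans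
      ((hc.strictMonoOn_snd one_pos).monotoneOn hz (mem_Ioi.2 (by positivity))
        (mul_le_mul_of_nonneg_left (by linarith) hG0.le))
  have hcp := hc.pos _ _ hy hz
  have hfoc := hp.foc_rent hU hc hγ t
  rw [h2, h3, hc.dy_scale htr hy hz, hc.homogeneous _ _ _ htr hy hz,
    Real.mul_rpow htr.le hcp.le] at hfoc
  have hr := hp.rent_pos hU t
  have hpow : (e₁ * G ^ t) ^ γ = e₁ ^ (γ - 1) * (G ^ (γ - 1)) ^ t * (e₁ * G ^ t) := by
    rw [← Real.rpow_mul_natCast hG0.le, mul_comm (γ - 1), Real.rpow_natCast_mul hG0.le,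
      ← Real.mul_rpow he.le (pow_pos hG0 t).le, Real.rpow_sub_one htr.ne',
      div_mul_cancel₀ _ htr.ne']
  rw [div_le_iff₀ htr, div_mul_eq_mul_div, div_mul_eq_mul_div, div_mul_eq_mul_div,
    le_div_iff₀ hk]
  calc p.r t * dy c 1 (G * w)
      ≤ p.r t * dy c (1 - share G e₁ p t) (G * (w + share G e₁ p (t + 1))) :=
        mul_le_mul_of_nonneg_left hdy hr.le
    _ = deriv v 1 * ((e₁ * G ^ t) ^ γ *
          c (1 - share G e₁ p t) (G * (w + share G e₁ p (t + 1))) ^ γ) := hfoc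
    _ ≤ deriv v 1 * ((e₁ * G ^ t) ^ γ * c 1 (G * (w + 1)) ^ γ) :=
        mul_le_mul_of_nonneg_left (mul_le_mul_of_nonneg_left
          (Real.rpow_le_rpow hcp.le hcle hγ0.le) (Real.rpow_pos_of_pos htr γ).le) hm.le
    _ = _ := by
        rw [hpow]
        ring

/-- If housing expenditure is asymptotically a positive share of trend income, the shares of rent
in housing expenditure are summable. As `p.q t * p.P t` is nonincreasing, at a late enough date the
present value of rents is then less than the price. -/
lemma tendsto_zero_of_noBubble (hp : IsEquilibrium E p) (hG : EndowmentAssumption E G e₁ e₂)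
    (hU : UtilityAssumption E c γ v) (hc : CompositeAssumption c) (hγ : γ < 1)
    {x : ℝ} (hlim : Tendsto (share G e₁ p) atTop (𝓝 x)) (hnb : p.NoBubble) : x = 0 := by
  by_contra hne
  have hx : 0 < x := (ge_of_tendsto' hlim fun t => (hp.share_pos hG hU t).le).lt_of_ne' hne
  have hG0 : 0 < G := zero_lt_one.trans hG.one_lt
  obtain ⟨K, hK⟩ := hp.exists_rent_le hG hU hc hγ
  have hρpos : ∀ t, 0 < p.r t / p.S t := fun t => div_pos (hp.rent_pos hU t) (hp.S_pos hU t)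
  have hsum : Summable (fun t => p.r t / p.S t) := by
    have hgeo : Summable (fun t : ℕ => 2 / x * K * (G ^ (γ - 1)) ^ t) :=
      (summable_geometric_of_lt_one (Real.rpow_pos_of_pos hG0 _).le
        (Real.rpow_lt_one_of_one_lt_of_neg hG.one_lt (by linarith))).mul_left _
    refine Summable.of_norm_bounded_eventually_nat hgeo ?_
    filter_upwards [hK, hlim.eventually (lt_mem_nhds (half_lt_self hx))] with t h1 h2
    rw [Real.norm_of_nonneg (hρpos t).le]
    have htr := hG.trend_pos t
    have hr := div_pos (hp.rent_pos hU t) htr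
    have e : p.r t / p.S t = p.r t / (e₁ * G ^ t) / share G e₁ p t := by
      rw [share, div_div_div_cancel_right₀ htr.ne']
    rw [e]
    calc p.r t / (e₁ * G ^ t) / share G e₁ p t
        ≤ p.r t / (e₁ * G ^ t) / (x / 2) := div_le_div_of_nonneg_left hr.le (half_pos hx) h2.le
      _ = 2 / x * (p.r t / (e₁ * G ^ t)) := by field_simp
      _ ≤ 2 / x * (K * (G ^ (γ - 1)) ^ t) := mul_le_mul_of_nonneg_left h1 (by positivity)
      _ = _ := (mul_assoc _ _ _).symm
  obtain ⟨N, hN⟩ := (((tendsto_add_atTop_iff_nat 1).2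
    (tendsto_sum_nat_add fun t => p.r t / p.S t)).eventually (gt_mem_nhds one_pos)).exists
  have hsumN : Summable (fun n => p.r (n + (N + 1)) / p.S (n + (N + 1))) :=
    (summable_nat_add_iff (f := fun t => p.r t / p.S t) (N + 1)).2 hsum
  have hpos : 0 < p.q N * p.P N := mul_pos (hp.q_pos hU hc hγ N) (hp.price_pos hU hc hγ N)
  obtain ⟨hsr, hV⟩ := hnb N
  have hV' : p.q N * p.P N = ∑' n, p.q (N + 1 + n) * p.r (N + 1 + n) := by
    rw [hV, MarketPath.V, ← mul_assoc, mul_one_div_cancel (hp.q_pos hU hc hγ N).ne', one_mul]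
  have hle : ∑' n, p.q (N + 1 + n) * p.r (N + 1 + n) ≤
      ∑' n, p.q N * p.P N * (p.r (n + (N + 1)) / p.S (n + (N + 1))) := by
    refine hsr.tsum_le_tsum (fun n => ?_) (hsumN.mul_left _)
    have h1 := hp.price_antitone hU hc hγ (Nat.le_add_right N n)
    simp only at h1
    rw [← hp.q_succ_mul_S hU hc hγ (N + n)] at h1
    have hS := (hp.S_pos hU (N + n + 1)).ne'
    have h2 := mul_le_mul_of_nonneg_right h1 (hρpos (N + n + 1)).le
    rw [show N + 1 + n = N + n + 1 by omega, show n + (N + 1) = N + n + 1 by omega]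
    refine le_trans (le_of_eq ?_) h2
    field_simp
  rw [tsum_mul_left, ← hV'] at hle
  have := mul_lt_mul_of_pos_left hN hpos
  linarith

end IsEquilibrium

lemma tendsto_share {ξ : ℝ × ℝ} (h : Tendsto (auxVar γ G e₁ p) atTop (𝓝 ξ)) :
    Tendsto (share G e₁ p) atTop (𝓝 ξ.1) :=
  (continuous_fst.tendsto ξ).comp h

end HousingOLG

theorem proposition3 (E : Economy) (c : ℝ → ℝ → ℝ) (v : ℝ → ℝ) (γ G e₁ e₂ : ℝ)
    (hG : EndowmentAssumption E G e₁ e₂) (hU : UtilityAssumption E c γ v)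
    (hc : CompositeAssumption c) (hγ : γ < 1) :
    ∃ wb : ℝ, IsBubbleThreshold c G wb ∧ (∀ w' : ℝ, IsBubbleThreshold c G w' → w' = wb) ∧
      -- above the threshold every equilibrium is efficient
      (wb ≤ e₂ / e₁ → ∀ p : MarketPath, IsEquilibrium E p → ParetoEfficient E p.toAllocation) ∧
      -- below it, long run equilibria that converge to a bubbly steady state are efficient
      (e₂ / e₁ < wb → ∀ p : MarketPath, IsLongRunEquilibrium E γ G e₁ p →
        (∃ ξ : ℝ × ℝ, IsBubblySteadyState c γ G (e₂ / e₁) (deriv v 1) ξ ∧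
          Tendsto (auxVar γ G e₁ p) atTop (𝓝 ξ)) →
        ParetoEfficient E p.toAllocation) ∧
      -- below it, long run equilibria without bubble, and those that converge to the fundamental
      -- steady state, are inefficient
      (e₂ / e₁ < wb → ∀ p : MarketPath, IsLongRunEquilibrium E γ G e₁ p →
        (p.NoBubble ∨ Tendsto (auxVar γ G e₁ p) atTop (𝓝 (0, 0))) →
        ¬ ParetoEfficient E p.toAllocation) := by
  have hG0 : 0 < G := zero_lt_one.trans hG.one_lt
  obtain ⟨wb, hwb⟩ := hc.exists_isBubbleThreshold hG0
  refine ⟨wb, hwb, fun w' h' => hwb.unique hc hG0 h',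
    fun hw p hp => hp.paretoEfficient_of_threshold_le hG hU hc hγ hwb hw, ?_, ?_⟩
  · rintro - p ⟨hp, -⟩ ⟨ξ, hξ, hlim⟩
    exact hp.paretoEfficient_of_bubbly hG hU hc hγ hξ (tendsto_share hlim)
  · rintro hw p ⟨hp, ξ, hlim⟩ hfund
    refine hp.not_paretoEfficient_of_tendsto_zero hG hU hc hγ hwb hw ?_
    rcases hfund with hnb | h0
    · have h := tendsto_share hlim
      rwa [hp.tendsto_zero_of_noBubble hG hU hc hγ h hnb] at h
    · exact tendsto_share h0
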